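/- Let $\wp$ be a probability mass function supported on a finite set of positive integers whose greatest common divisor is $1$, and let $T$ be an integer with $T\ge\max(\mathrm{supp}\,\wp)$. Let $n=\max(\mathrm{supp}\,\wp)$ and $$C=\Big(\sum_{i=1}^{n}\sum_{j=i}^{n}\wp(j)\Big)^{-1}.$$ For $L\ge1$ let $A_L$ be the cycle graph with vertices $v_1,\dots,v_{L+1}$ and sink $v_{L+1}$. A pure configuration is a function $c:\{v_1,\dots,v_L\}\to\mathbb Z$; a configuration is a finite formal convex combination of pure configurations. A pure configuration is stable if all its values are $<T$, and nonnegative if all its values are $\ge 0$; a configuration is stable (nonnegative) if all the pure configurations occurring in it are. To topple a pure configuration at $v$, sample $\gamma$ from $\wp$, subtract $2\gamma$ from the value at $v$ and add $\gamma$ to each of the two neighbours of $v$ (sand sent to the sink is lost; if $L=1$ both neighbours of $v_1$ are the sink). Fix a choice algorithm, which selects in each unstable pure configuration a vertex with value $\ge T$; the stabilization of a configuration is obtained by toppling its unstable pure parts repeatedly at the selected vertices until everything is stable. For configurations $S=\sum p_i[c_i]$ and $D=\sum q_j[d_j]$, let $S\oplus D$ be the stabilization of $\sum p_iq_j[c_i+d_j]$.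 A steady state is a stable configuration $S$ with $S\oplus D=S$ for every nonnegative stable configuration $D$. For a pure configuration $c$ put $$\log(\mathrm{RHF})(c)=\frac{1}{(L+1)^2}\sum_{i=1}^{L}(L+1-i)\,c(v_i),$$ and for $S=\sum p_i[c_i]$ let the average of $\log(\mathrm{RHF})$ in $S$ be $\sum p_i\log(\mathrm{RHF})(c_i)$. Then for every $\varepsilon>0$ there is $L_0$ such that for all $L\ge L_0$ and every choice algorithm on $A_L$: 1. a steady state exists, and if $T\ge 2\max(\mathrm{supp}\,\wp)$ there is a nonnegative one; 2. if $T\ge2$, the steady state is unique; 3. in every steady state the average of $\log(\mathrm{RHF})$ is at most $$\frac T2-\frac{C^{-1}}{e^2}+\varepsilon .$$ The constant $C^{-1}/e^2$ depends only on $\wp$, not on $L$. -/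

import Mathlib

/-!
The stochastic sandpile (SSP) on the cycle graph `A_L` with vertices `v_1, …, v_{L+1}` and sink
`v_{L+1}`.  The non-sink vertex `v_i` is the element `i - 1` of `Fin L`.
-/

namespace SSP

/-- A pure configuration: an integer height at each non-sink vertex. -/
abbrev PureConfig (L : ℕ) : Type := Fin L → ℤ

/-- Finite formal real combinations of pure configurations; `Finsupp.single c 1` is `[c]`. -/
abbrev FormalSum (L : ℕ) : Type := PureConfig L →₀ ℝ

/-- A (mixed) configuration: a finite formal sum `∑ pᵢ [cᵢ]` with nonnegative weights of sum `1`
(the `cᵢ` with positive weight are those in the support). -/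
def IsConfig {L : ℕ} (C : FormalSum L) : Prop :=
  (∀ c, 0 ≤ C c) ∧ ∑ c ∈ C.support, C c = 1

/-- A pure configuration is stable if every height is below the threshold. -/
def PureStable {L : ℕ} (T : ℤ) (c : PureConfig L) : Prop := ∀ v, c v < T

/-- A configuration is stable if it is a sum of stable pure configurations. -/
def Stable {L : ℕ} (T : ℤ) (C : FormalSum L) : Prop := ∀ c ∈ C.support, PureStable T c

/-- A configuration is nonnegative if it is a sum of nonnegative pure configurations. -/
def Nonneg {L : ℕ} (C : FormalSum L) : Prop := ∀ c ∈ C.support, ∀ v, 0 ≤ c v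

/-- Topple `c` at `v` with increment `γ`: every vertex of the cycle has degree `2`, so `v` loses
`2γ` and each of its two neighbours receives `γ` (what goes to the sink is lost). -/
def toppleBy {L : ℕ} (γ : ℕ) (v : Fin L) (c : PureConfig L) : PureConfig L := fun w =>
  c w - (if w = v then 2 * (γ : ℤ) else 0)
    + (if (v : ℕ) + 1 = w then (γ : ℤ) else 0) + (if (w : ℕ) + 1 = v then (γ : ℤ) else 0)

/-- The mixed configuration `T_v(c)` obtained by toppling `c` at `v` with an increment sampled
from the mass function `p`. -/
noncomputable def toppleAt {L : ℕ} (p : ℕ →₀ ℝ) (v : Fin L) (c : PureConfig L) : FormalSum L :=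
  p.sum fun γ q => Finsupp.single (toppleBy γ v c) q

/-- A choice algorithm selects, in each unstable pure configuration, a vertex that can be
toppled legally. -/
structure ChoiceAlgorithm (L : ℕ) (T : ℤ) where
  /-- the selected vertex -/
  choose : {c : PureConfig L // ¬ PureStable T c} → Fin L
  /-- its height is at least the threshold -/
  legal : ∀ c : {c : PureConfig L // ¬ PureStable T c}, T ≤ c.1 (choose c)

open Classical in
/-- Topple a pure configuration once, if it is unstable, at the vertex selected by `A`. -/
noncomputable def topplePure {L : ℕ} {T : ℤ} (p : ℕ →₀ ℝ) (A : ChoiceAlgorithm L T)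
    (c : PureConfig L) : FormalSum L :=
  if h : PureStable T c then Finsupp.single c 1 else toppleAt p (A.choose ⟨c, h⟩) c

/-- Topple a mixed configuration once: its stable parts stay, the others are toppled once. -/
noncomputable def topple {L : ℕ} {T : ℤ} (p : ℕ →₀ ℝ) (A : ChoiceAlgorithm L T)
    (C : FormalSum L) : FormalSum L :=
  C.sum fun c q => q • topplePure p A c

/-- `D` is the stabilization of `C`: toppling `C` repeatedly until it becomes stable gives `D`.
Since a stable `D` is left unchanged by `topple`, there is at most one such `D`. -/
def IsStabilization {L : ℕ} {T : ℤ} (p : ℕ →₀ ℝ) (A : ChoiceAlgorithm L T)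
    (C D : FormalSum L) : Prop :=
  Stable T D ∧ ∃ n : ℕ, (topple p A)^[n] C = D

/-- The sum `∑ᵢⱼ pᵢ qⱼ [cᵢ + dⱼ]` of `∑ pᵢ [cᵢ]` and `∑ qⱼ [dⱼ]` (this is not the sum of
`FormalSum L` as a vector space). -/
noncomputable def addConfig {L : ℕ} (C D : FormalSum L) : FormalSum L :=
  C.sum fun c q => D.sum fun d r => Finsupp.single (c + d) (q * r)

/-- A steady state: a stable configuration `S` with `S ⊕ C = S` for every nonnegative stable
configuration `C`, where `S ⊕ C` is the stabilization of `S + C`. -/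
def IsSteadyState {L : ℕ} {T : ℤ} (p : ℕ →₀ ℝ) (A : ChoiceAlgorithm L T)
    (S : FormalSum L) : Prop :=
  IsConfig S ∧ Stable T S ∧
    ∀ C : FormalSum L, IsConfig C → Nonneg C → Stable T C →
      IsStabilization p A (addConfig S C) S

/-- The smallest `n` such that `p` is supported in `{1, …, n}`. -/
def maxIncrement (p : ℕ →₀ ℝ) : ℕ := p.support.sup id

/-- The normalizing constant `C = (∑_{i=1}^n ∑_{j=i}^n p(j))⁻¹`. -/
noncomputable def normConst (p : ℕ →₀ ℝ) : ℝ :=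
  (∑ i ∈ Finset.Icc 1 (maxIncrement p), ∑ j ∈ Finset.Icc i (maxIncrement p), p j)⁻¹

/-- `log(RHF) = (L+1)⁻² ∑_{i=1}^L (L+1-i) rᵢ` of the pure configuration with heights `rᵢ`; the
index `i` is `v + 1`. -/
noncomputable def logRHF {L : ℕ} (c : PureConfig L) : ℝ :=
  1 / ((L : ℝ) + 1) ^ 2 * ∑ v : Fin L, ((L : ℝ) + 1 - ((v : ℕ) + 1)) * (c v : ℝ)

/-- The average of `log(RHF)` over a mixed configuration. -/
noncomputable def avgLogRHF {L : ℕ} (C : FormalSum L) : ℝ :=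
  C.sum fun c q => q * logRHF c

end SSP

/-! Toppling translates a configuration by a multiple of a column of the reduced Laplacian, so
topplings commute. A concave quadratic potential makes legal toppling terminate, and the diamond
argument then makes the stabilization independent of the choice algorithm. Hence stabilizing first
and adding nonnegative sand later gives the same result as adding everything at once.

Existence is an averaging argument: stabilize the uniform distribution on a large box. One extra
grain changes it only on two faces of the box, so a limit point, which exists because all results
live in one finite set of configurations, absorbs grains. For `T ≥ 2` a single grain is a stable
test configuration, so a steady state absorbs all nonnegative configurations; stabilizing a
nonnegative shift of `S + S'` then gives both `S` and `S'`.

The bound on the average is an entropy argument. Each vertex emits sand along a renewal process with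
increment law `p`. Since `S` is unchanged by adding nonnegative sand, every vertex may be given an
independent random delay distributed by the stationary law `C · tail`; the chance that a prescribed
total is a renewal epoch is then at most `C`. By injectivity of the Laplacian the final
configuration determines all totals, so every configuration has weight at most `C ^ L` in `S`
(`IsSteadyState.apply_le`). On the other hand few stable configurations are close to the threshold:
the sum of `exp (-s * deficit)` over them is at most `s⁻ᴸ / L!`. Jensen's inequality and `Lᴸ / L! ≤
eᴸ`, with the optimal `s`, force the mean deficit to be at least `C⁻¹ L² / e²`. -/

namespace SSP

/-- The standing assumptions on the mass function `p` of the increments and the threshold `T`. -/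
structure IsIncrementLaw (p : ℕ →₀ ℝ) (T : ℤ) : Prop where
  zero : p 0 = 0
  nonneg : ∀ j, 0 ≤ p j
  sum_eq_one : ∑ j ∈ p.support, p j = 1
  le_threshold : ∀ j ∈ p.support, (j : ℤ) ≤ T

theorem IsIncrementLaw.pos {p : ℕ →₀ ℝ} {T : ℤ} (hp : IsIncrementLaw p T) {j : ℕ}
    (hj : j ∈ p.support) : 0 < j := by
  rcases Nat.eq_zero_or_pos j with rfl | h
  · exact absurd hp.zero (Finsupp.mem_support_iff.mp hj)
  · exact h

theorem IsIncrementLaw.threshold_pos {p : ℕ →₀ ℝ} {T : ℤ} (hp : IsIncrementLaw p T) : 0 < T := by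
  have hne : p.support.Nonempty := by
    rw [Finset.nonempty_iff_ne_empty]
    intro h
    have := hp.sum_eq_one
    simp [h] at this
  obtain ⟨j, hj⟩ := hne
  have h1 := hp.pos hj
  have h2 := hp.le_threshold j hj
  omega

/-! ### The Laplacian of the cycle with sink -/

variable {L : ℕ}

/-- The reduced Laplacian of the cycle graph `A_L`. -/
def lap (Γ : Fin L → ℤ) : PureConfig L := fun w =>
  2 * Γ w - (∑ v : Fin L, if (v : ℕ) + 1 = w then Γ v else 0)
    - ∑ v : Fin L, if (w : ℕ) + 1 = v then Γ v else 0

theorem lap_add (Γ Γ' : Fin L → ℤ) : lap (Γ + Γ') = lap Γ + lap Γ' := by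
  funext w
  have h : ∀ (P : Fin L → Prop) [DecidablePred P],
      (∑ v : Fin L, if P v then Γ v + Γ' v else 0)
        = (∑ v : Fin L, if P v then Γ v else 0) + ∑ v : Fin L, if P v then Γ' v else 0 := by
    intro P _
    rw [← Finset.sum_add_distrib]
    exact Finset.sum_congr rfl fun v _ => by split_ifs <;> simp
  simp only [lap, Pi.add_apply, h]
  ring

theorem lap_zero : lap (0 : Fin L → ℤ) = 0 := by
  funext w
  simp [lap]

theorem lap_sub (Γ Γ' : Fin L → ℤ) : lap (Γ - Γ') = lap Γ - lap Γ' := by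
  rw [eq_sub_iff_add_eq, ← lap_add, sub_add_cancel]

/-- Toppling is a translation in the group of configurations; commutation of topplings and
compatibility with adding sand follow at once. -/
theorem toppleBy_eq_sub_lap (γ : ℕ) (v : Fin L) (c : PureConfig L) :
    toppleBy γ v c = c - lap (Pi.single v (γ : ℤ)) := by
  funext w
  have h : ∀ (P : Fin L → Prop) [DecidablePred P],
      (∑ u : Fin L, if P u then (Pi.single v (γ : ℤ) : Fin L → ℤ) u else 0)
        = if P v then (γ : ℤ) else 0 := by
    intro P _
    rw [Finset.sum_eq_single v]
    · simp
    · intro b _ hb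
      simp [hb]
    · simp
  simp only [toppleBy, lap, Pi.sub_apply, h]
  rw [Pi.single_apply]
  split_ifs <;> ring

theorem toppleBy_comm (γ δ : ℕ) (v w : Fin L) (c : PureConfig L) :
    toppleBy γ v (toppleBy δ w c) = toppleBy δ w (toppleBy γ v c) := by
  simp only [toppleBy_eq_sub_lap]
  abel

theorem toppleBy_add (γ : ℕ) (v : Fin L) (c e : PureConfig L) :
    toppleBy γ v (c + e) = toppleBy γ v c + e := by
  simp only [toppleBy_eq_sub_lap]
  abel

theorem le_toppleBy (γ : ℕ) {v w : Fin L} (h : w ≠ v) (c : PureConfig L) :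
    c w ≤ toppleBy γ v c w := by
  simp only [toppleBy, h, if_false]
  split_ifs <;> omega

theorem sub_le_toppleBy (γ : ℕ) (v w : Fin L) (c : PureConfig L) :
    c w - (if w = v then 2 * (γ : ℤ) else 0) ≤ toppleBy γ v c w := by
  simp only [toppleBy]
  split_ifs <;> omega

/-- Summation by parts for the Laplacian. -/
theorem sum_mul_lap (f : ℤ → ℤ) (h0 : f (-1) = 0) (hL : f L = 0) (Γ : Fin L → ℤ) :
    ∑ w : Fin L, f (w : ℕ) * lap Γ w
      = ∑ v : Fin L, Γ v * (2 * f (v : ℕ) - f ((v : ℕ) - 1) - f ((v : ℕ) + 1)) := by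
  have h1 : ∀ v : Fin L, (∑ w : Fin L, f (w : ℕ) * (if (v : ℕ) + 1 = w then Γ v else 0))
      = Γ v * f ((v : ℕ) + 1) := by
    intro v
    by_cases hv : (v : ℕ) + 1 < L
    · rw [Finset.sum_eq_single ⟨(v : ℕ) + 1, hv⟩]
      · simp [mul_comm]
      · intro b _ hb
        rw [if_neg, mul_zero]
        intro h
        exact hb (Fin.ext h.symm)
      · simp
    · have h2 : ((v : ℕ) : ℤ) + 1 = L := by have := v.2; omega
      rw [h2, hL, mul_zero]
      refine Finset.sum_eq_zero fun w _ => ?_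
      rw [if_neg, mul_zero]
      have := w.2
      omega
  have h2 : ∀ v : Fin L, (∑ w : Fin L, f (w : ℕ) * (if (w : ℕ) + 1 = v then Γ v else 0))
      = Γ v * f ((v : ℕ) - 1) := by
    intro v
    by_cases hv : (v : ℕ) = 0
    · rw [hv]
      simp [h0]
    · have h3 : (v : ℕ) - 1 < L := by have := v.2; omega
      rw [Finset.sum_eq_single ⟨(v : ℕ) - 1, h3⟩]
      · have h4 : (v : ℕ) - 1 + 1 = v := by omega
        have h5 : (((v : ℕ) - 1 : ℕ) : ℤ) = (v : ℕ) - 1 := by omega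
        simp [h4, h5, mul_comm]
      · intro b _ hb
        rw [if_neg, mul_zero]
        intro h
        exact hb (Fin.ext (by simp; omega))
      · simp
  simp only [lap, mul_sub, Finset.sum_sub_distrib, Finset.mul_sum]
  rw [Finset.sum_comm (f := fun w v : Fin L => f (w : ℕ) * (if (v : ℕ) + 1 = w then Γ v else 0)),
    Finset.sum_comm (f := fun w v : Fin L => f (w : ℕ) * (if (w : ℕ) + 1 = v then Γ v else 0))]
  simp only [h1, h2]
  have : ∀ v : Fin L, f (v : ℕ) * (2 * Γ v) = Γ v * (2 * f (v : ℕ)) := fun v => by ring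
  simp only [this]
  ring

/-- Pairing with the Green's function at `u` recovers `(L + 1) * Γ u`: the tent `f` below vanishes
at `-1` and `L`, the two copies of the sink, and is linear away from `u`. -/
theorem lap_injective : Function.Injective (lap : (Fin L → ℤ) → PureConfig L) := by
  have key : ∀ Γ : Fin L → ℤ, lap Γ = 0 → Γ = 0 := by
    intro Γ hΓ
    funext u
    let f : ℤ → ℤ := fun x => (min x (u : ℕ) + 1) * (L - max x (u : ℕ))
    have hu := u.2
    have h := sum_mul_lap f (by simp [f]) (by simp only [f]; rw [max_eq_left (by omega)]; simp) Γ
    have hf : ∀ v : Fin L, Γ v * (2 * f (v : ℕ) - f ((v : ℕ) - 1) - f ((v : ℕ) + 1))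
        = if v = u then Γ v * (L + 1) else 0 := by
      intro v
      simp only [f]
      rcases lt_trichotomy (v : ℕ) (u : ℕ) with hlt | heq | hgt
      · rw [if_neg (by rintro rfl; omega)]
        rw [min_eq_left (by omega), min_eq_left (by omega), min_eq_left (by omega),
          max_eq_right (by omega), max_eq_right (by omega), max_eq_right (by omega)]
        ring
      · rw [if_pos (Fin.ext heq), heq]
        rw [min_eq_left (by omega), min_eq_left (by omega), min_eq_right (by omega),
          max_eq_right (by omega), max_eq_right (by omega), max_eq_left (by omega)]
        ring
      · rw [if_neg (by rintro rfl; omega)]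
        rw [min_eq_right (by omega), min_eq_right (by omega), min_eq_right (by omega),
          max_eq_left (by omega), max_eq_left (by omega), max_eq_left (by omega)]
        ring
    simp only [hf, hΓ] at h
    simp only [Pi.zero_apply, mul_zero, Finset.sum_const_zero, Finset.sum_ite_eq',
      Finset.mem_univ, if_true] at h
    rcases mul_eq_zero.mp h.symm with h | h
    · exact h
    · omega
  intro Γ Γ' h
  rw [← sub_eq_zero]
  exact key _ (by rw [lap_sub, h, sub_self])

/-! ### Termination of the toppling process -/

/-- The potential that decreases at each toppling. -/
def potential (c : PureConfig L) : ℤ := ∑ w : Fin L, (((w : ℕ) : ℤ) + 1) * (L - (w : ℕ)) * c w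

/-- The weight `(x + 1) * (L - x)` vanishes at both copies of the sink and has constant second
difference `-2`. -/
theorem potential_toppleBy (γ : ℕ) (v : Fin L) (c : PureConfig L) :
    potential (toppleBy γ v c) = potential c - 2 * γ := by
  have h := sum_mul_lap (L := L) (fun x => (x + 1) * (L - x)) (by simp) (by simp)
    (Pi.single v (γ : ℤ))
  have hv : ∀ g : Fin L → ℤ, ∑ u, (Pi.single v (γ : ℤ) : Fin L → ℤ) u * g u = γ * g v := by
    intro g
    rw [Finset.sum_eq_single v (by intro b _ hb; simp [hb]) (by simp), Pi.single_eq_same]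
  rw [hv] at h
  have h2 : potential (toppleBy γ v c) = potential c
      - ∑ w : Fin L, (((w : ℕ) : ℤ) + 1) * (L - (w : ℕ)) * lap (Pi.single v (γ : ℤ)) w := by
    simp only [potential, toppleBy_eq_sub_lap, ← Finset.sum_sub_distrib, ← mul_sub, Pi.sub_apply]
  rw [h2, h]
  ring

theorem potential_mono {c d : PureConfig L} (h : ∀ w, c w ≤ d w) : potential c ≤ potential d := by
  refine Finset.sum_le_sum fun w _ => mul_le_mul_of_nonneg_left (h w) ?_
  have := w.2
  exact mul_nonneg (by omega) (by omega)

theorem le_toppleBy_of_legal {p : ℕ →₀ ℝ} {T : ℤ} {m : ℤ} (hm : ∀ j ∈ p.support, m ≤ T - 2 * (j : ℤ))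
    {c : PureConfig L} (hc : ∀ w, m ≤ c w) {v : Fin L} (hv : T ≤ c v) {γ : ℕ}
    (hγ : γ ∈ p.support) (w : Fin L) : m ≤ toppleBy γ v c w := by
  have h1 := sub_le_toppleBy γ v w c
  have h2 := hm γ hγ
  have h3 := hc w
  split_ifs at h1 with h
  · subst h
    omega
  · omega

/-- Induction along legal topplings. -/
theorem topple_induction {p : ℕ →₀ ℝ} {T : ℤ} (hp : IsIncrementLaw p T) {P : PureConfig L → Prop}
    (h : ∀ c, (∀ v, T ≤ c v → ∀ γ ∈ p.support, P (toppleBy γ v c)) → P c)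
    (c : PureConfig L) : P c := by
  -- Legal topplings never push a height below `m`: a toppled vertex keeps at least `T - 2 * j ≥
  -- -T`, and the others only gain. So the potential stays above that of the constant `m`, and
  -- induction on the excess terminates.
  obtain ⟨m, hmT, hmc⟩ : ∃ m : ℤ, (∀ j ∈ p.support, m ≤ T - 2 * (j : ℤ)) ∧ ∀ w, m ≤ c w := by
    obtain ⟨m, hm⟩ := (Set.finite_range c).bddBelow
    refine ⟨min m (-T), fun j hj => ?_, fun w => (min_le_left _ _).trans (hm ⟨w, rfl⟩)⟩
    have := hp.le_threshold j hj
    have := min_le_right m (-T)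
    omega
  have key : ∀ n : ℕ, ∀ c : PureConfig L, (∀ w, m ≤ c w) →
      potential c < potential (fun _ : Fin L => m) + n → P c := by
    intro n
    induction n with
    | zero =>
      intro c hc hn
      have := potential_mono hc
      simp only [Nat.cast_zero, add_zero] at hn
      exact absurd this (not_le.mpr hn)
    | succ n ih =>
      intro c hc hn
      refine h c fun v hv γ hγ => ih _ (le_toppleBy_of_legal hmT hc hv hγ) ?_
      rw [potential_toppleBy]
      have := hp.pos hγ
      push_cast at hn
      omega
  refine key (potential c - potential (fun _ : Fin L => m) + 1).toNat c hmc ?_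
  omega

/-! ### Stabilization -/

variable {T : ℤ}

/-- `topple` as a linear map. -/
noncomputable def toppleLin (p : ℕ →₀ ℝ) (A : ChoiceAlgorithm L T) :
    Module.End ℝ (FormalSum L) :=
  Finsupp.linearCombination ℝ (topplePure p A)

theorem topple_iterate (p : ℕ →₀ ℝ) (A : ChoiceAlgorithm L T) (n : ℕ) (C : FormalSum L) :
    (topple p A)^[n] C = (toppleLin p A ^ n) C := by
  rw [Module.End.coe_pow]
  rfl

theorem toppleAt_eq_sum (p : ℕ →₀ ℝ) (v : Fin L) (c : PureConfig L) :
    toppleAt p v c = ∑ γ ∈ p.support, p γ • Finsupp.single (toppleBy γ v c) (1 : ℝ) := by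
  simp [toppleAt, Finsupp.sum]

theorem toppleLin_single (p : ℕ →₀ ℝ) (A : ChoiceAlgorithm L T) (c : PureConfig L) :
    toppleLin p A (Finsupp.single c 1) = topplePure p A c := by
  simp [toppleLin]

theorem stable_sum {ι : Type*} (s : Finset ι) (a : ι → ℝ) (D : ι → FormalSum L)
    (h : ∀ i ∈ s, Stable T (D i)) : Stable T (∑ i ∈ s, a i • D i) := by
  classical
  intro c hc
  rw [Finsupp.mem_support_iff, Finsupp.finsetSum_apply] at hc
  obtain ⟨i, hi, hne⟩ := Finset.exists_ne_zero_of_sum_ne_zero hc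
  refine h i hi c ?_
  rw [Finsupp.mem_support_iff]
  intro h0
  simp [h0] at hne

/-- The iterates are eventually constant, not merely stable once; this lets finitely many branches
be combined at the supremum of their times. -/
theorem exists_stabilize {p : ℕ →₀ ℝ} (hp : IsIncrementLaw p T) (A : ChoiceAlgorithm L T)
    (c : PureConfig L) : ∃ D : FormalSum L, Stable T D ∧
      ∃ n, ∀ k, n ≤ k → (toppleLin p A ^ k) (Finsupp.single c 1) = D := by
  classical
  induction c using topple_induction hp with
  | h c ih =>
  by_cases hc : PureStable T c
  · refine ⟨Finsupp.single c 1, ?_, 0, fun k _ => ?_⟩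
    · intro d hd
      rw [Finset.mem_singleton.mp (Finsupp.support_single_subset hd)]
      exact hc
    · induction k with
      | zero => rfl
      | succ k ihk =>
        rw [pow_succ, Module.End.mul_apply, toppleLin_single, topplePure, dif_pos hc, ihk (by simp)]
  · set v := A.choose ⟨c, hc⟩ with hv
    have hl : T ≤ c v := A.legal ⟨c, hc⟩
    choose! D hD n hn using ih v hl
    refine ⟨∑ γ ∈ p.support, p γ • D γ, stable_sum _ _ _ hD, p.support.sup n + 1, fun k hk => ?_⟩
    obtain ⟨k, rfl⟩ : ∃ l, k = l + 1 := ⟨k - 1, by omega⟩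
    rw [pow_succ, Module.End.mul_apply, toppleLin_single, topplePure, dif_neg hc, toppleAt_eq_sum,
      map_sum]
    refine Finset.sum_congr rfl fun γ hγ => ?_
    rw [map_smul, hn γ hγ k]
    exact (Finset.le_sup hγ).trans (by omega)

open Classical in
/-- The stabilization of a pure configuration. -/
noncomputable def stabPure (p : ℕ →₀ ℝ) (A : ChoiceAlgorithm L T) (c : PureConfig L) :
    FormalSum L :=
  if h : ∃ D : FormalSum L, Stable T D ∧
      ∃ n, ∀ k, n ≤ k → (toppleLin p A ^ k) (Finsupp.single c 1) = D
  then h.choose else 0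

/-- The stabilization of a configuration, as a linear map. -/
noncomputable def stab (p : ℕ →₀ ℝ) (A : ChoiceAlgorithm L T) :
    FormalSum L →ₗ[ℝ] FormalSum L :=
  Finsupp.linearCombination ℝ (stabPure p A)

theorem stab_single (p : ℕ →₀ ℝ) (A : ChoiceAlgorithm L T) (c : PureConfig L) :
    stab p A (Finsupp.single c 1) = stabPure p A c := by
  simp [stab]

theorem toppleLin_of_stable (p : ℕ →₀ ℝ) (A : ChoiceAlgorithm L T) {C : FormalSum L} (hC : Stable T C) : toppleLin p A C = C := by
  conv_rhs => rw [← Finsupp.sum_single C]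
  rw [toppleLin, Finsupp.linearCombination_apply]
  refine Finset.sum_congr rfl fun c hc => ?_
  have h : topplePure p A c = Finsupp.single c 1 := dif_pos (hC c hc)
  simp [h]

theorem stab_eq_sum (p : ℕ →₀ ℝ) (A : ChoiceAlgorithm L T) (C : FormalSum L) :
    stab p A C = ∑ c ∈ C.support, C c • stabPure p A c := rfl

section
variable {p : ℕ →₀ ℝ} (hp : IsIncrementLaw p T) (A : ChoiceAlgorithm L T)
include hp

theorem stabPure_spec (c : PureConfig L) : Stable T (stabPure p A c) ∧
    ∃ n, ∀ k, n ≤ k → (toppleLin p A ^ k) (Finsupp.single c 1) = stabPure p A c := by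
  rw [stabPure, dif_pos (exists_stabilize hp A c)]
  exact (exists_stabilize hp A c).choose_spec

theorem stable_stab (C : FormalSum L) : Stable T (stab p A C) :=
  stable_sum _ _ _ fun c _ => (stabPure_spec hp A c).1

theorem exists_pow_eq_stab (C : FormalSum L) :
    ∃ n, ∀ k, n ≤ k → (toppleLin p A ^ k) C = stab p A C := by
  choose n hn using fun c => (stabPure_spec hp A c).2
  refine ⟨C.support.sup n, fun k hk => ?_⟩
  have hC : C = ∑ c ∈ C.support, C c • Finsupp.single c (1 : ℝ) := by
    conv_lhs => rw [← Finsupp.sum_single C]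
    simp [Finsupp.sum]
  rw [stab_eq_sum]
  conv_lhs => rw [hC]
  rw [map_sum]
  refine Finset.sum_congr rfl fun c hc => ?_
  rw [map_smul, hn c k ((Finset.le_sup hc).trans hk)]

theorem stab_of_stable {C : FormalSum L} (hC : Stable T C) : stab p A C = C := by
  obtain ⟨n, hn⟩ := exists_pow_eq_stab hp A C
  rw [← hn n le_rfl]
  clear hn
  induction n with
  | zero => rfl
  | succ n ih => rw [pow_succ, Module.End.mul_apply, toppleLin_of_stable p A hC, ih]

theorem isStabilization_iff (C D : FormalSum L) : IsStabilization p A C D ↔ stab p A C = D := by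
  obtain ⟨n, hn⟩ := exists_pow_eq_stab hp A C
  constructor
  · rintro ⟨hD, k, hk⟩
    rw [topple_iterate] at hk
    have h : ∀ j, (toppleLin p A ^ j) D = D := by
      intro j
      induction j with
      | zero => rfl
      | succ j ih => rw [pow_succ, Module.End.mul_apply, toppleLin_of_stable p A hD, ih]
    rw [← hn (n + k) (by omega), pow_add, Module.End.mul_apply, hk, h]
  · rintro rfl
    exact ⟨stable_stab hp A C, n, by rw [topple_iterate, hn n le_rfl]⟩

theorem stab_toppleLin (C : FormalSum L) : stab p A (toppleLin p A C) = stab p A C := by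
  obtain ⟨n, hn⟩ := exists_pow_eq_stab hp A C
  obtain ⟨k, hk⟩ := exists_pow_eq_stab hp A (toppleLin p A C)
  rw [← hk (k + n) (by omega), ← hn (k + n + 1) (by omega), pow_succ, Module.End.mul_apply]

theorem stabPure_of_stable {c : PureConfig L} (hc : PureStable T c) :
    stabPure p A c = Finsupp.single c 1 := by
  rw [← stab_single, stab_of_stable hp A]
  intro d hd
  rw [Finset.mem_singleton.mp (Finsupp.support_single_subset hd)]
  exact hc

theorem stabPure_of_not_stable {c : PureConfig L} (hc : ¬ PureStable T c) :
    stabPure p A c = ∑ γ ∈ p.support, p γ • stabPure p A (toppleBy γ (A.choose ⟨c, hc⟩) c) := by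
  rw [← stab_single, ← stab_toppleLin hp, toppleLin_single, topplePure, dif_neg hc,
    toppleAt_eq_sum, map_sum]
  simp only [map_smul, stab_single]

/-- The abelian property: a legal toppling does not change the stabilization. -/
theorem stabPure_topple {c : PureConfig L} {v : Fin L} (hv : T ≤ c v) :
    stabPure p A c = ∑ γ ∈ p.support, p γ • stabPure p A (toppleBy γ v c) := by
  induction c using topple_induction hp generalizing v with
  | h c ih =>
  have hc : ¬ PureStable T c := fun h => absurd (h v) (not_lt.mpr hv)
  rw [stabPure_of_not_stable hp A hc]
  set w := A.choose ⟨c, hc⟩ with hw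
  have hl : T ≤ c w := A.legal ⟨c, hc⟩
  by_cases hvw : v = w
  · rw [hvw]
  -- Diamond argument: toppling at one vertex cannot lower the other, so both remain legal in either
  -- order, and the two double sums agree termwise after exchanging summations.
  · have h1 : ∀ γ ∈ p.support, p γ • stabPure p A (toppleBy γ w c)
        = ∑ δ ∈ p.support, p γ • p δ • stabPure p A (toppleBy δ v (toppleBy γ w c)) := by
      intro γ hγ
      rw [ih w hl γ hγ (hv.trans (le_toppleBy γ hvw c)), Finset.smul_sum]
    have h2 : ∀ γ ∈ p.support, p γ • stabPure p A (toppleBy γ v c)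
        = ∑ δ ∈ p.support, p γ • p δ • stabPure p A (toppleBy δ w (toppleBy γ v c)) := by
      intro γ hγ
      rw [ih v hv γ hγ (hl.trans (le_toppleBy γ (Ne.symm hvw) c)), Finset.smul_sum]
    rw [Finset.sum_congr rfl h1, Finset.sum_congr rfl h2, Finset.sum_comm]
    refine Finset.sum_congr rfl fun γ _ => Finset.sum_congr rfl fun δ _ => ?_
    rw [toppleBy_comm, smul_comm]

end

/-- Adding the pure configuration `e` to all parts of a configuration. -/
noncomputable def shift (e : PureConfig L) : FormalSum L →ₗ[ℝ] FormalSum L :=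
  Finsupp.lmapDomain ℝ ℝ (· + e)

theorem shift_single (e c : PureConfig L) (r : ℝ) :
    shift e (Finsupp.single c r) = Finsupp.single (c + e) r := by
  simp [shift]

theorem shift_shift (e e' : PureConfig L) (C : FormalSum L) :
    shift e' (shift e C) = shift (e + e') C := by
  simp only [shift, Finsupp.lmapDomain_apply, ← Finsupp.mapDomain_comp]
  congr 1
  funext c
  exact add_assoc c e e'

section
variable {p : ℕ →₀ ℝ} (hp : IsIncrementLaw p T) (A : ChoiceAlgorithm L T)
include hp

/-- Extra nonnegative sand keeps every legal toppling legal, so the topplings that stabilize `c` can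
be carried out with `e` on top; the abelian property allows them although `A` might choose other
vertices. -/
theorem stab_shift_stab {e : PureConfig L} (he : 0 ≤ e) (C : FormalSum L) :
    stab p A (shift e (stab p A C)) = stab p A (shift e C) := by
  have key : ∀ c, stab p A (shift e (stabPure p A c)) = stabPure p A (c + e) := by
    intro c
    induction c using topple_induction hp with
    | h c ih =>
    by_cases hc : PureStable T c
    · rw [stabPure_of_stable hp A hc, shift_single, stab_single]
    · have hl : T ≤ c (A.choose ⟨c, hc⟩) := A.legal ⟨c, hc⟩
      have hl' : T ≤ (c + e) (A.choose ⟨c, hc⟩) := le_add_of_le_of_nonneg hl (he _)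
      rw [stabPure_of_not_stable hp A hc, stabPure_topple hp A hl', map_sum, map_sum]
      refine Finset.sum_congr rfl fun γ hγ => ?_
      rw [map_smul, map_smul, ih _ hl γ hγ, toppleBy_add]
  have h : (stab p A ∘ₗ shift e) ∘ₗ stab p A = stab p A ∘ₗ shift e := by
    refine Finsupp.lhom_ext' fun c => LinearMap.ext_ring ?_
    simp [stab_single, shift_single, key]
  exact LinearMap.congr_fun h C

/-- Nonnegativity is preserved by stabilization. -/
theorem stabPure_nonneg (c d : PureConfig L) : 0 ≤ stabPure p A c d := by
  classical
  induction c using topple_induction hp with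
  | h c ih =>
  by_cases hc : PureStable T c
  · rw [stabPure_of_stable hp A hc, Finsupp.single_apply]
    split_ifs <;> norm_num
  · rw [stabPure_of_not_stable hp A hc, Finsupp.finsetSum_apply]
    exact Finset.sum_nonneg fun γ hγ =>
      mul_nonneg (hp.nonneg γ) (ih _ (A.legal ⟨c, hc⟩) γ hγ)

theorem stab_nonneg {C : FormalSum L} (hC : ∀ c, 0 ≤ C c) (d : PureConfig L) :
    0 ≤ stab p A C d := by
  rw [stab_eq_sum, Finsupp.finsetSum_apply]
  exact Finset.sum_nonneg fun c _ => mul_nonneg (hC c) (stabPure_nonneg hp A c d)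

end

/-- The total weight of a formal sum. -/
noncomputable def mass : FormalSum L →ₗ[ℝ] ℝ := Finsupp.linearCombination ℝ fun _ => 1

theorem mass_eq_sum (C : FormalSum L) : mass C = ∑ c ∈ C.support, C c := by
  simp [mass, Finsupp.linearCombination_apply, Finsupp.sum]

theorem mass_single (c : PureConfig L) (r : ℝ) : mass (Finsupp.single c r) = r := by
  simp [mass]

theorem isConfig_iff (C : FormalSum L) : IsConfig C ↔ (∀ c, 0 ≤ C c) ∧ mass C = 1 := by
  rw [mass_eq_sum, IsConfig]

section
variable {p : ℕ →₀ ℝ} (hp : IsIncrementLaw p T) (A : ChoiceAlgorithm L T)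
include hp

theorem mass_stabPure (c : PureConfig L) : mass (stabPure p A c) = 1 := by
  induction c using topple_induction hp with
  | h c ih =>
  by_cases hc : PureStable T c
  · rw [stabPure_of_stable hp A hc, mass_single]
  · rw [stabPure_of_not_stable hp A hc, map_sum, ← hp.sum_eq_one]
    refine Finset.sum_congr rfl fun γ hγ => ?_
    rw [map_smul, ih _ (A.legal ⟨c, hc⟩) γ hγ, smul_eq_mul, mul_one]

theorem mass_stab (C : FormalSum L) : mass (stab p A C) = mass C := by
  rw [stab_eq_sum, map_sum, mass_eq_sum]
  refine Finset.sum_congr rfl fun c _ => ?_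
  rw [map_smul, mass_stabPure hp, smul_eq_mul, mul_one]

theorem stabPure_le_one (c d : PureConfig L) : stabPure p A c d ≤ 1 := by
  by_cases hd : d ∈ (stabPure p A c).support
  · rw [← mass_stabPure hp A c, mass_eq_sum]
    exact Finset.single_le_sum (fun e _ => stabPure_nonneg hp A c e) hd
  · rw [Finsupp.notMem_support_iff.mp hd]
    exact zero_le_one

/-- Lower bounds on the heights are preserved by stabilization. -/
theorem le_of_mem_support_stabPure {m : ℤ} (hm : ∀ j ∈ p.support, m ≤ T - 2 * (j : ℤ))
    {c : PureConfig L} (hc : ∀ w, m ≤ c w) {d : PureConfig L}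
    (hd : d ∈ (stabPure p A c).support) (w : Fin L) : m ≤ d w := by
  induction c using topple_induction hp with
  | h c ih =>
  by_cases hs : PureStable T c
  · rw [stabPure_of_stable hp A hs] at hd
    rw [Finset.mem_singleton.mp (Finsupp.support_single_subset hd)]
    exact hc w
  · rw [stabPure_of_not_stable hp A hs, Finsupp.mem_support_iff, Finsupp.finsetSum_apply] at hd
    obtain ⟨γ, hγ, hne⟩ := Finset.exists_ne_zero_of_sum_ne_zero hd
    have hl := A.legal ⟨c, hs⟩
    refine ih _ hl γ hγ (le_toppleBy_of_legal hm hc hl hγ) ?_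
    rw [Finsupp.mem_support_iff]
    intro h0
    simp [h0] at hne

end

/-! ### Steady states -/

theorem addConfig_eq_sum_shift (C D : FormalSum L) :
    addConfig C D = ∑ e ∈ D.support, D e • shift e C := by
  have h : ∀ e, D e • shift e C = ∑ c ∈ C.support, Finsupp.single (c + e) (C c * D e) := by
    intro e
    conv_lhs => rw [← Finsupp.sum_single C]
    simp only [Finsupp.sum, map_sum, shift_single, Finset.smul_sum, Finsupp.smul_single,
      smul_eq_mul]
    exact Finset.sum_congr rfl fun c _ => by rw [mul_comm]
  simp only [h]
  rw [Finset.sum_comm]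
  rfl

theorem addConfig_comm (C D : FormalSum L) : addConfig C D = addConfig D C := by
  simp only [addConfig, Finsupp.sum]
  rw [Finset.sum_comm]
  refine Finset.sum_congr rfl fun d _ => Finset.sum_congr rfl fun c _ => ?_
  rw [add_comm, mul_comm]

theorem shift_addConfig (e : PureConfig L) (C D : FormalSum L) :
    shift e (addConfig C D) = addConfig C (shift e D) := by
  rw [addConfig_comm C D, addConfig_comm C (shift e D), addConfig_eq_sum_shift,
    addConfig_eq_sum_shift, map_sum]
  refine Finset.sum_congr rfl fun c _ => ?_
  rw [map_smul, shift_shift, shift_shift, add_comm]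

theorem mass_shift (e : PureConfig L) (C : FormalSum L) : mass (shift e C) = mass C := by
  have : mass ∘ₗ shift e = mass := by
    refine Finsupp.lhom_ext' fun c => LinearMap.ext_ring ?_
    simp [shift_single, mass_single]
  exact LinearMap.congr_fun this C

theorem exists_nonneg_shift (C : FormalSum L) : ∃ e : PureConfig L, 0 ≤ e ∧ Nonneg (shift e C) := by
  classical
  refine ⟨∑ c ∈ C.support, |c|, Finset.sum_nonneg fun c _ => abs_nonneg c, ?_⟩
  intro d hd v
  obtain ⟨c, hc, rfl⟩ := Finset.mem_image.mp (Finsupp.mapDomain_support hd)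
  have h1 : |c| v ≤ (∑ c ∈ C.support, |c|) v :=
    Finset.single_le_sum (f := fun c : PureConfig L => |c|) (fun c _ => abs_nonneg c) hc v
  have h2 : -|c v| ≤ c v := neg_abs_le _
  rw [Pi.abs_apply] at h1
  rw [Pi.add_apply]
  omega

theorem Nonneg.shift {C : FormalSum L} (hC : Nonneg C) {f : PureConfig L} (hf : 0 ≤ f) :
    Nonneg (shift f C) := by
  classical
  intro d hd v
  obtain ⟨c, hc, rfl⟩ := Finset.mem_image.mp (Finsupp.mapDomain_support hd)
  exact add_nonneg (hC c hc v) (hf v)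

section
variable {p : ℕ →₀ ℝ} (hp : IsIncrementLaw p T) (A : ChoiceAlgorithm L T)
include hp

/-- The nonnegative configurations absorbed by `S` form a submonoid, and single grains generate all
of them. -/
theorem shift_invariant_of_single {S : FormalSum L} (hS : stab p A S = S)
    (h : ∀ v, stab p A (shift (Pi.single v 1) S) = S) {e : PureConfig L} (he : 0 ≤ e) :
    stab p A (shift e S) = S := by
  let I : AddSubmonoid (PureConfig L) :=
    { carrier := {e | 0 ≤ e ∧ stab p A (shift e S) = S}
      zero_mem' := by
        refine ⟨le_rfl, ?_⟩
        have : shift 0 S = S := by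
          simp only [shift, Finsupp.lmapDomain_apply, add_zero]
          exact Finsupp.mapDomain_id
        rw [this, hS]
      add_mem' := by
        rintro a b ⟨ha, hSa⟩ ⟨hb, hSb⟩
        refine ⟨add_nonneg ha hb, ?_⟩
        rw [← shift_shift, ← stab_shift_stab hp A hb, hSa, hSb] }
  have hmem : e = ∑ v, (e v).toNat • (Pi.single v 1 : PureConfig L) := by
    funext w
    rw [Finset.sum_apply, Finset.sum_eq_single w]
    · simp [Int.toNat_of_nonneg (he w)]
    · intro b _ hb
      simp [hb.symm]
    · simp
  have : e ∈ I := by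
    rw [hmem]
    have h1 : ∀ v, Pi.single v 1 ∈ I := fun v => ⟨Pi.single_nonneg.mpr zero_le_one, h v⟩
    exact sum_mem fun v _ => nsmul_mem (h1 v) _
  exact this.2

theorem isSteadyState_of_shift_invariant {S : FormalSum L} (hS : IsConfig S) (hst : Stable T S)
    (h : ∀ v, stab p A (shift (Pi.single v 1) S) = S) : IsSteadyState p A S := by
  refine ⟨hS, hst, fun C hC hC0 _ => ?_⟩
  rw [isStabilization_iff hp, addConfig_eq_sum_shift, map_sum]
  have : ∀ e ∈ C.support, stab p A (C e • shift e S) = C e • S := by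
    intro e he
    rw [map_smul, shift_invariant_of_single hp A (stab_of_stable hp A hst) h fun v => hC0 e he v]
  rw [Finset.sum_congr rfl this, ← Finset.sum_smul, hC.2, one_smul]

/-- If `T ≥ 2`, steady states absorb all nonnegative pure configurations. -/
theorem IsSteadyState.stab_shift (hT : 2 ≤ T) {S : FormalSum L} (hS : IsSteadyState p A S)
    {e : PureConfig L} (he : 0 ≤ e) : stab p A (shift e S) = S := by
  refine shift_invariant_of_single hp A (stab_of_stable hp A hS.2.1) (fun v => ?_) he
  -- A single grain is itself a stable test configuration only because `1 < T`.
  have h := hS.2.2 (Finsupp.single (Pi.single v 1) 1) ?_ ?_ ?_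
  · rw [isStabilization_iff hp, addConfig_eq_sum_shift] at h
    rwa [Finsupp.support_single _ one_ne_zero, Finset.sum_singleton, Finsupp.single_eq_same,
      one_smul] at h
  · classical
    rw [isConfig_iff, mass_single]
    refine ⟨fun c => ?_, rfl⟩
    rw [Finsupp.single_apply]
    split_ifs <;> norm_num
  · intro c hc w
    rw [Finset.mem_singleton.mp (Finsupp.support_single_subset hc), Pi.single_apply]
    split_ifs <;> norm_num
  · intro c hc w
    rw [Finset.mem_singleton.mp (Finsupp.support_single_subset hc), Pi.single_apply]
    split_ifs <;> omega

theorem IsSteadyState.stab_addConfig (hT : 2 ≤ T) {S : FormalSum L} (hS : IsSteadyState p A S)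
    {C : FormalSum L} (hC : mass C = 1) (hC0 : Nonneg C) : stab p A (addConfig S C) = S := by
  rw [addConfig_eq_sum_shift, map_sum]
  have : ∀ e ∈ C.support, stab p A (C e • shift e S) = C e • S := by
    intro e he
    rw [map_smul, hS.stab_shift hp A hT fun v => hC0 e he v]
  rw [Finset.sum_congr rfl this, ← Finset.sum_smul, ← mass_eq_sum, hC, one_smul]

/-- Steady states may have negative heights, so `e + e'` is added first. The sum of `S`, `S'` and
this shift can then be read as nonnegative sand added to either one. -/
theorem IsSteadyState.unique (hT : 2 ≤ T) {S S' : FormalSum L} (hS : IsSteadyState p A S)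
    (hS' : IsSteadyState p A S') : S = S' := by
  have hm := ((isConfig_iff S).mp hS.1).2
  have hm' := ((isConfig_iff S').mp hS'.1).2
  obtain ⟨e, he, heS⟩ := exists_nonneg_shift S
  obtain ⟨e', he', heS'⟩ := exists_nonneg_shift S'
  have h1 := hS'.stab_addConfig hp A hT (C := shift (e + e') S)
    (by rw [mass_shift, hm]) (by rw [← shift_shift]; exact heS.shift he')
  have h2 := hS.stab_addConfig hp A hT (C := shift (e + e') S')
    (by rw [mass_shift, hm']) (by rw [add_comm, ← shift_shift]; exact heS'.shift he)
  rw [← shift_addConfig] at h1 h2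
  rw [← h2, addConfig_comm, h1]

end

/-! ### Existence of a steady state -/

/-- The box of configurations with heights in `{0, …, N - 1}`. -/
noncomputable def box (L N : ℕ) : Finset (PureConfig L) := Fintype.piFinset fun _ => Finset.Ico 0 (N : ℤ)

theorem card_box (L N : ℕ) : (box L N).card = N ^ L := by
  simp [box]

theorem card_box_filter (N : ℕ) (v : Fin L) (a : ℤ) :
    ((box L N).filter fun c => c v = a).card ≤ N ^ (L - 1) := by
  calc ((box L N).filter fun c => c v = a).card
      ≤ (Fintype.piFinset fun w : Fin L =>
          if w = v then {a} else Finset.Ico 0 (N : ℤ)).card := by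
        refine Finset.card_le_card fun c hc => ?_
        simp only [box, Finset.mem_filter, Fintype.mem_piFinset] at hc ⊢
        intro w
        by_cases h : w = v
        · subst h
          simp [hc.2]
        · rw [if_neg h]
          exact hc.1 w
    _ = ∏ w : Fin L, if w = v then 1 else N := by
        rw [Fintype.card_piFinset]
        refine Finset.prod_congr rfl fun w _ => ?_
        split_ifs <;> simp
    _ = N ^ (L - 1) := by
        rw [Finset.prod_ite]
        simp [Finset.filter_ne']

/-- The box and its translate by a grain have equal size and differ only in one face each. -/
theorem abs_sum_box_sub_le (N : ℕ) (v : Fin L) (g : PureConfig L → ℝ) (h0 : ∀ c, 0 ≤ g c)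
    (h1 : ∀ c, g c ≤ 1) :
    |∑ c ∈ box L N, g (c + Pi.single v 1) - ∑ c ∈ box L N, g c| ≤ (N : ℝ) ^ (L - 1) := by
  classical
  set s := box L N
  set t := s.map (addRightEmbedding (Pi.single v (1 : ℤ)))
  have hst : ∑ c ∈ s, g (c + Pi.single v 1) = ∑ c ∈ t, g c := by
    rw [Finset.sum_map]
    rfl
  have hcard : t.card = s.card := Finset.card_map _
  have h2 : (s \ t).card ≤ N ^ (L - 1) := by
    refine (Finset.card_le_card fun c hc => ?_).trans (card_box_filter N v 0)
    rw [Finset.mem_sdiff] at hc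
    refine Finset.mem_filter.mpr ⟨hc.1, ?_⟩
    by_contra hne
    refine hc.2 (Finset.mem_map.mpr ⟨c - Pi.single v 1, ?_, sub_add_cancel _ _⟩)
    have hc1 := hc.1
    simp only [s, box, Fintype.mem_piFinset, Finset.mem_Ico] at hc1 ⊢
    intro w
    have := hc1 w
    rw [Pi.sub_apply, Pi.single_apply]
    split_ifs with h
    · subst h
      omega
    · omega
  have h3 : (t \ s).card ≤ N ^ (L - 1) := by
    have e1 := Finset.card_sdiff_add_card_inter s t
    have e2 := Finset.card_sdiff_add_card_inter t s
    rw [Finset.inter_comm] at e2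
    omega
  have hb : ∀ u : Finset (PureConfig L), ∑ c ∈ u, g c ≤ u.card := by
    intro u
    refine (Finset.sum_le_sum fun c _ => h1 c).trans ?_
    simp
  have hb0 : ∀ u : Finset (PureConfig L), 0 ≤ ∑ c ∈ u, g c := fun u =>
    Finset.sum_nonneg fun c _ => h0 c
  have h2' : ((s \ t).card : ℝ) ≤ (N : ℝ) ^ (L - 1) := by exact_mod_cast h2
  have h3' : ((t \ s).card : ℝ) ≤ (N : ℝ) ^ (L - 1) := by exact_mod_cast h3
  have e := Finset.sum_sdiff_sub_sum_sdiff (s₁ := t) (s₂ := s) (f := g)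
  rw [hst, abs_le]
  constructor <;> linarith [hb (s \ t), hb (t \ s), hb0 (s \ t), hb0 (t \ s)]

section
variable {p : ℕ →₀ ℝ} (hp : IsIncrementLaw p T) (A : ChoiceAlgorithm L T)
include hp

/-- Existence of a steady state above a given level. -/
theorem exists_steadyState {m : ℤ} (hm0 : m ≤ 0) (hm : ∀ j ∈ p.support, m ≤ T - 2 * (j : ℤ)) :
    ∃ S : FormalSum L, IsSteadyState p A S ∧ ∀ c ∈ S.support, ∀ v, m ≤ c v := by
  classical
  -- One finite set carries every stabilization of a nonnegative configuration, whatever the box;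
  -- this gives the compactness used below.
  set Ω : Finset (PureConfig L) := Fintype.piFinset fun _ => Finset.Ico m T
  have hΩ : ∀ c : PureConfig L, 0 ≤ c → (stabPure p A c).support ⊆ Ω := by
    intro c hc d hd
    simp only [Ω, Fintype.mem_piFinset, Finset.mem_Ico]
    exact fun w => ⟨le_of_mem_support_stabPure hp A hm (fun w => hm0.trans (hc w)) hd w,
      (stabPure_spec hp A c).1 d hd w⟩
  let U : ℕ → FormalSum L := fun N =>
    ((N : ℝ) ^ L)⁻¹ • ∑ c ∈ box L N, Finsupp.single c (1 : ℝ)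
  -- The index `N + 1` keeps the box nonempty and the normalization nonzero.
  let a : ℕ → FormalSum L := fun N => stab p A (U (N + 1))
  have hUs : ∀ N v, shift (Pi.single v 1) (U N)
      = ((N : ℝ) ^ L)⁻¹ • ∑ c ∈ box L N, Finsupp.single (c + Pi.single v 1) (1 : ℝ) := by
    intro N v
    simp [U, map_sum, shift_single]
  have hU0 : ∀ N c, 0 ≤ U N c := by
    intro N c
    simp only [U, Finsupp.smul_apply, Finsupp.finsetSum_apply, smul_eq_mul]
    refine mul_nonneg (by positivity) (Finset.sum_nonneg fun d _ => ?_)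
    rw [Finsupp.single_apply]
    split_ifs <;> norm_num
  have hU1 : ∀ N, mass (U (N + 1)) = 1 := by
    intro N
    simp only [U, map_smul, map_sum, mass_single]
    rw [Finset.sum_const, card_box]
    have : ((N + 1 : ℕ) : ℝ) ^ L ≠ 0 := by positivity
    simp only [nsmul_eq_mul, mul_one, smul_eq_mul]
    push_cast at this ⊢
    exact inv_mul_cancel₀ this
  have ha0 : ∀ N c, 0 ≤ a N c := fun N c => stab_nonneg hp A (hU0 _) c
  have hasupp : ∀ N c, c ∉ Ω → a N c = 0 := by
    intro N c hc
    simp only [a, U, map_smul, map_sum, stab_single, Finsupp.smul_apply, Finsupp.finsetSum_apply]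
    rw [Finset.sum_eq_zero, smul_zero]
    intro d hd
    refine Finsupp.notMem_support_iff.mp fun h => hc (hΩ d ?_ h)
    simp only [box, Fintype.mem_piFinset, Finset.mem_Ico] at hd
    exact fun w => (hd w).1
  have ha1 : ∀ N, ∑ c ∈ Ω, a N c = 1 := by
    intro N
    rw [← hU1 N, ← mass_stab hp A, mass_eq_sum]
    refine (Finset.sum_subset (fun c hc => ?_) fun c _ hc => ?_).symm
    · by_contra h
      exact (Finsupp.mem_support_iff.mp hc) (hasupp N c h)
    · exact Finsupp.notMem_support_iff.mp hc
  have ha_le : ∀ N c, c ∈ Ω → a N c ≤ 1 := by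
    intro N c hc
    rw [← ha1 N]
    exact Finset.single_le_sum (fun c _ => ha0 N c) hc
  have hinv : ∀ N v d, |stab p A (shift (Pi.single v 1) (a N)) d - a N d|
      ≤ 1 / ((N : ℝ) + 1) := by
    intro N v d
    have hL : 0 < L := v.pos
    rw [stab_shift_stab hp A (Pi.single_nonneg.mpr zero_le_one), hUs]
    simp only [a, U, map_smul, map_sum, stab_single, Finsupp.smul_apply, Finsupp.finsetSum_apply]
    rw [← smul_sub, smul_eq_mul, abs_mul, abs_of_nonneg (by positivity)]
    have h := abs_sum_box_sub_le (N + 1) v (fun c => stabPure p A c d)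
      (fun c => stabPure_nonneg hp A c d) (fun c => stabPure_le_one hp A c d)
    refine (mul_le_mul_of_nonneg_left h (by positivity)).trans (le_of_eq ?_)
    have hN : ((N : ℝ) + 1) ≠ 0 := by positivity
    push_cast
    obtain ⟨l, rfl⟩ : ∃ l, L = l + 1 := ⟨L - 1, by omega⟩
    simp only [Nat.add_sub_cancel]
    field_simp
    ring
  -- The weights on `Ω` lie in a compact cube. Along the subsequence the `1 / (N + 1)` defect of
  -- invariance vanishes, and the invariance of the limit is a finite sum of limits.
  obtain ⟨b, hb, φ, hφ, hlim⟩ := (isCompact_univ_pi (X := fun _ : Ω => ℝ)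
    (s := fun _ => Set.Icc 0 1) fun _ => isCompact_Icc).tendsto_subseq
    (x := fun N (c : Ω) => a N c) fun N c _ => ⟨ha0 N c, ha_le N c c.2⟩
  have hlim' : ∀ c : Ω, Filter.Tendsto (fun k => a (φ k) c) Filter.atTop (nhds (b c)) :=
    fun c => (tendsto_pi_nhds.mp hlim) c
  let β : PureConfig L → ℝ := fun c => if h : c ∈ Ω then b ⟨c, h⟩ else 0
  have hβ : ∀ c, Filter.Tendsto (fun k => a (φ k) c) Filter.atTop (nhds (β c)) := by
    intro c
    by_cases h : c ∈ Ω
    · simpa only [β, dif_pos h] using hlim' ⟨c, h⟩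
    · simp only [β, dif_neg h, hasupp _ c h]
      exact tendsto_const_nhds
  have hβΩ : ∀ c, β c ≠ 0 → c ∈ Ω := by
    intro c hc
    by_contra h
    exact hc (dif_neg h)
  let S : FormalSum L := Finsupp.onFinset Ω β hβΩ
  have hSsupp : S.support ⊆ Ω := Finsupp.support_onFinset_subset
  have hsum : ∀ (C : FormalSum L), (∀ c, c ∉ Ω → C c = 0) → ∀ v d,
      stab p A (shift (Pi.single v 1) C) d
        = ∑ c ∈ Ω, C c * stabPure p A (c + Pi.single v 1) d := by
    intro C hC v d
    have hCs : C = ∑ c ∈ Ω, C c • Finsupp.single c (1 : ℝ) := by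
      ext d
      rw [Finsupp.finsetSum_apply]
      simp only [Finsupp.smul_apply, Finsupp.single_apply, smul_eq_mul, mul_ite, mul_one, mul_zero,
        Finset.sum_ite_eq']
      split_ifs with h
      · rfl
      · exact hC d h
    conv_lhs => rw [hCs]
    simp only [map_sum, map_smul, shift_single, stab_single, Finsupp.finsetSum_apply,
      Finsupp.smul_apply, smul_eq_mul]
  refine ⟨S, isSteadyState_of_shift_invariant hp A ?_ ?_ ?_, ?_⟩
  · rw [isConfig_iff]
    refine ⟨fun c => ge_of_tendsto' (hβ c) fun k => ha0 _ c, ?_⟩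
    rw [mass_eq_sum, Finset.sum_subset hSsupp fun c _ hc => Finsupp.notMem_support_iff.mp hc]
    refine tendsto_nhds_unique (tendsto_finsetSum Ω fun c _ => hβ c) ?_
    simp only [ha1]
    exact tendsto_const_nhds
  · intro c hc v
    have := hSsupp hc
    simp only [Ω, Fintype.mem_piFinset, Finset.mem_Ico] at this
    exact (this v).2
  · intro v
    ext d
    rw [hsum S fun c hc => Finsupp.notMem_support_iff.mp fun h => hc (hSsupp h)]
    have h1 : Filter.Tendsto (fun k => ∑ c ∈ Ω, a (φ k) c * stabPure p A (c + Pi.single v 1) d)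
        Filter.atTop (nhds (∑ c ∈ Ω, S c * stabPure p A (c + Pi.single v 1) d)) :=
      tendsto_finsetSum Ω fun c _ => (hβ c).mul_const _
    have h2 : Filter.Tendsto (fun k => (∑ c ∈ Ω, a (φ k) c * stabPure p A (c + Pi.single v 1) d)
        - a (φ k) d) Filter.atTop (nhds 0) := by
      have h3 : Filter.Tendsto (fun k => 1 / ((φ k : ℝ) + 1)) Filter.atTop (nhds 0) :=
        tendsto_one_div_add_atTop_nhds_zero_nat.comp hφ.tendsto_atTop
      refine squeeze_zero_norm (fun k => ?_) h3
      rw [← hsum (a (φ k)) (hasupp _), Real.norm_eq_abs]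
      exact hinv _ v d
    have h3 := tendsto_nhds_unique h2 (h1.sub (hβ d))
    exact (sub_eq_zero.mp h3.symm)
  · intro c hc v
    have := hSsupp hc
    simp only [Ω, Fintype.mem_piFinset, Finset.mem_Ico] at this
    exact (this v).1

end

/-! ### The renewal function -/

/-- The renewal function of `p`: the expected number of visits at `m` of the random walk on `ℕ`
started at `0` whose increments are sampled from `p`. -/
noncomputable def renewalNat (p : ℕ →₀ ℝ) (m : ℕ) : ℝ :=
  (if m = 0 then 1 else 0)
    + ∑ j ∈ p.support, if _h : 0 < j ∧ j ≤ m then p j * renewalNat p (m - j) else 0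
termination_by m
decreasing_by omega

/-- The renewal function, extended by `0` to the negative integers. -/
noncomputable def renewal (p : ℕ →₀ ℝ) (z : ℤ) : ℝ := if z < 0 then 0 else renewalNat p z.toNat

theorem renewal_of_neg (p : ℕ →₀ ℝ) {z : ℤ} (hz : z < 0) : renewal p z = 0 := if_pos hz

/-- The tail `∑_{j ≥ i} p(j)`. -/
noncomputable def tail (p : ℕ →₀ ℝ) (i : ℕ) : ℝ := ∑ j ∈ Finset.Icc i (maxIncrement p), p j

theorem le_maxIncrement {p : ℕ →₀ ℝ} {j : ℕ} (hj : j ∈ p.support) : j ≤ maxIncrement p :=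
  Finset.le_sup (f := id) hj

theorem tail_eq_add (p : ℕ →₀ ℝ) {i : ℕ} (hi : i ≤ maxIncrement p) :
    tail p i = p i + tail p (i + 1) := by
  rw [tail, tail, ← Finset.insert_Icc_add_one_left_eq_Icc hi, Finset.sum_insert (by simp)]

theorem tail_maxIncrement_add_one (p : ℕ →₀ ℝ) : tail p (maxIncrement p + 1) = 0 := by
  simp [tail]

theorem inv_normConst (p : ℕ →₀ ℝ) :
    (normConst p)⁻¹ = ∑ i ∈ Finset.Icc 1 (maxIncrement p), tail p i := inv_inv _

theorem sum_Icc_one_eq_sum_range (f : ℕ → ℝ) (n : ℕ) :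
    ∑ i ∈ Finset.Icc 1 n, f i = ∑ i ∈ Finset.range n, f (i + 1) := by
  induction n with
  | zero => simp
  | succ n ih => rw [Finset.sum_Icc_succ_top (by omega), Finset.sum_range_succ, ih]

theorem sum_support_eq_sum_range (p : ℕ →₀ ℝ) (f : ℕ → ℝ) :
    ∑ j ∈ p.support, p j * f j = ∑ j ∈ Finset.range (maxIncrement p + 1), p j * f j := by
  refine Finset.sum_subset (fun j hj => ?_) fun j _ hj => ?_
  · rw [Finset.mem_range]
    exact Nat.lt_succ_of_le (le_maxIncrement hj)
  · rw [Finsupp.notMem_support_iff.mp hj, zero_mul]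

section
variable {p : ℕ →₀ ℝ} (hp : IsIncrementLaw p T)
include hp

theorem renewalNat_nonneg (m : ℕ) : 0 ≤ renewalNat p m := by
  induction m using Nat.strong_induction_on with
  | _ m ih =>
  rw [renewalNat]
  refine add_nonneg (by split_ifs <;> norm_num) (Finset.sum_nonneg fun j _ => ?_)
  split_ifs with h
  · exact mul_nonneg (hp.nonneg j) (ih _ (by omega))
  · exact le_rfl

theorem renewal_nonneg (z : ℤ) : 0 ≤ renewal p z := by
  rw [renewal]
  split_ifs
  · exact le_rfl
  · exact renewalNat_nonneg hp _

/-- The renewal equation. -/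
theorem renewal_eq (z : ℤ) :
    renewal p z = (if z = 0 then 1 else 0) + ∑ j ∈ p.support, p j * renewal p (z - j) := by
  by_cases hz : z < 0
  · rw [renewal_of_neg p hz, if_neg hz.ne, Finset.sum_eq_zero, add_zero]
    intro j _
    rw [renewal_of_neg p (by omega), mul_zero]
  · rw [renewal, if_neg hz, renewalNat]
    congr 1
    · by_cases h0 : z = 0
      · simp [h0]
      · rw [if_neg h0, if_neg (by omega)]
    · refine Finset.sum_congr rfl fun j hj => ?_
      have hj0 := hp.pos hj
      split_ifs with h
      · rw [renewal, if_neg (by omega)]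
        congr 2
        omega
      · rw [renewal_of_neg p (by omega), mul_zero]

theorem tail_zero : tail p 0 = 1 := by
  have h := sum_support_eq_sum_range p fun _ => 1
  simp only [mul_one, hp.sum_eq_one] at h
  rw [h, tail, Finset.range_eq_Ico, ← Finset.Ico_succ_right_eq_Icc]
  rfl

theorem tail_nonneg (i : ℕ) : 0 ≤ tail p i := Finset.sum_nonneg fun j _ => hp.nonneg j

theorem one_le_maxIncrement : 1 ≤ maxIncrement p := by
  by_contra h
  have h0 : maxIncrement p = 0 := by omega
  have := tail_zero hp
  simp [tail, h0, hp.zero] at this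

theorem tail_one : tail p 1 = 1 := by
  rw [← tail_zero hp, tail_eq_add p (Nat.zero_le _), hp.zero, zero_add]

theorem inv_normConst_pos : 0 < (normConst p)⁻¹ := by
  rw [inv_normConst]
  refine lt_of_lt_of_le zero_lt_one ((tail_one hp).symm.le.trans ?_)
  exact Finset.single_le_sum (f := tail p) (fun i _ => tail_nonneg hp i)
    (Finset.mem_Icc.mpr ⟨le_rfl, one_le_maxIncrement hp⟩)

theorem normConst_pos : 0 < normConst p := inv_pos.mp (inv_normConst_pos hp)

/-- Since `p i = tail p i - tail p (i + 1)`, summation by parts turns the renewal equation into a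
conservation law in `z`, with a unit jump at `z = 0`. -/
theorem sum_tail_mul_renewal_succ (z : ℤ) :
    ∑ i ∈ Finset.Icc 1 (maxIncrement p), tail p i * renewal p (z + 1 - i)
      = (∑ i ∈ Finset.Icc 1 (maxIncrement p), tail p i * renewal p (z - i))
        + if z = 0 then 1 else 0 := by
  set n := maxIncrement p with hn
  have h1 : ∑ i ∈ Finset.Icc 1 n, tail p i * renewal p (z - i)
      = (∑ i ∈ Finset.range (n + 1), tail p i * renewal p (z - i)) - renewal p z := by
    rw [sum_Icc_one_eq_sum_range (fun i => tail p i * renewal p (z - i)), Finset.sum_range_succ']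
    simp [tail_zero hp]
  have h2 : ∑ i ∈ Finset.Icc 1 n, tail p i * renewal p (z + 1 - i)
      = ∑ i ∈ Finset.range (n + 1), (tail p i - p i) * renewal p (z - i) := by
    rw [sum_Icc_one_eq_sum_range (fun i => tail p i * renewal p (z + 1 - i)),
      Finset.sum_range_succ _ n, tail_eq_add p (i := n) le_rfl, hn, tail_maxIncrement_add_one,
      ← hn, add_zero, sub_self, zero_mul, add_zero]
    refine Finset.sum_congr rfl fun i hi => ?_
    rw [tail_eq_add p (i := i) (by rw [Finset.mem_range] at hi; omega), add_sub_cancel_left]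
    congr 2
    push_cast
    ring
  rw [h1, h2]
  simp only [sub_mul, Finset.sum_sub_distrib]
  rw [← sum_support_eq_sum_range p fun i => renewal p (z - i)]
  have := renewal_eq hp z
  linarith

/-- The stationary delay makes the renewal density at most the one in equilibrium. -/
theorem sum_tail_mul_renewal_le_one (z : ℤ) :
    ∑ i ∈ Finset.Icc 1 (maxIncrement p), tail p i * renewal p (z - i) ≤ 1 := by
  have h0 : ∀ z : ℤ, z ≤ 0 →
      ∑ i ∈ Finset.Icc 1 (maxIncrement p), tail p i * renewal p (z - i) = 0 := by
    intro z hz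
    refine Finset.sum_eq_zero fun i hi => ?_
    rw [Finset.mem_Icc] at hi
    rw [renewal_of_neg p (by omega), mul_zero]
  -- The sum is `0` for `z ≤ 0`, jumps to `1`, and stays there.
  have h1 : ∀ k : ℕ,
      ∑ i ∈ Finset.Icc 1 (maxIncrement p), tail p i * renewal p ((k : ℤ) + 1 - i) = 1 := by
    intro k
    induction k with
    | zero =>
      rw [sum_tail_mul_renewal_succ hp, h0 _ (by simp)]
      simp
    | succ k ih =>
      rw [sum_tail_mul_renewal_succ hp, if_neg (by omega), add_zero]
      push_cast
      exact ih
  rcases le_or_gt z 0 with hz | hz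
  · rw [h0 z hz]
    exact zero_le_one
  · obtain ⟨k, rfl⟩ : ∃ k : ℕ, z = (k : ℤ) + 1 := ⟨(z - 1).toNat, by omega⟩
    exact (h1 k).le

end

/-! ### Upper bounds for the weights of a steady state -/

/-- The vectors of delays. -/
def delays (p : ℕ →₀ ℝ) (L : ℕ) : Finset (Fin L → ℕ) :=
  Fintype.piFinset fun _ => Finset.Icc 1 (maxIncrement p)

/-- The probability of a vector of independent stationary delays. -/
noncomputable def delayWeight (p : ℕ →₀ ℝ) (Γ : Fin L → ℕ) : ℝ :=
  ∏ v, normConst p * tail p (Γ v)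

/-- The configuration that undoes the delays, made nonnegative. -/
noncomputable def delayShift (p : ℕ →₀ ℝ) (Γ : Fin L → ℕ) : PureConfig L :=
  (fun _ => 2 * (maxIncrement p : ℤ)) - lap fun v => (Γ v : ℤ)

/-- Neighbours only decrease the Laplacian of a nonnegative vector, so it is at most `2 * Γ w`,
hence at most twice the largest increment. -/
theorem delayShift_nonneg {p : ℕ →₀ ℝ} {Γ : Fin L → ℕ} (hΓ : Γ ∈ delays p L) : 0 ≤ delayShift p Γ := by
  intro w
  have h1 := (Finset.mem_Icc.mp (Fintype.mem_piFinset.mp hΓ w)).2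
  have h2 : 0 ≤ ∑ v : Fin L, if (v : ℕ) + 1 = w then (Γ v : ℤ) else 0 :=
    Finset.sum_nonneg fun v _ => by split_ifs <;> omega
  have h3 : 0 ≤ ∑ v : Fin L, if (w : ℕ) + 1 = v then (Γ v : ℤ) else 0 :=
    Finset.sum_nonneg fun v _ => by split_ifs <;> omega
  simp only [delayShift, lap, Pi.sub_apply, Pi.zero_apply]
  omega

section
variable {p : ℕ →₀ ℝ} (hp : IsIncrementLaw p T) (A : ChoiceAlgorithm L T)
include hp

theorem exists_eq_sub_lap {c d : PureConfig L} (hd : d ∈ (stabPure p A c).support) :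
    ∃ Γ : Fin L → ℤ, d = c - lap Γ := by
  induction c using topple_induction hp with
  | h c ih =>
  by_cases hc : PureStable T c
  · rw [stabPure_of_stable hp A hc] at hd
    exact ⟨0, by rw [lap_zero, sub_zero, Finset.mem_singleton.mp (Finsupp.support_single_subset hd)]⟩
  · rw [stabPure_of_not_stable hp A hc, Finsupp.mem_support_iff, Finsupp.finsetSum_apply] at hd
    obtain ⟨γ, hγ, hne⟩ := Finset.exists_ne_zero_of_sum_ne_zero hd
    obtain ⟨Γ, hΓ⟩ := ih _ (A.legal ⟨c, hc⟩) γ hγ (by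
      rw [Finsupp.mem_support_iff]
      intro h0
      simp [h0] at hne)
    refine ⟨Pi.single (A.choose ⟨c, hc⟩) (γ : ℤ) + Γ, ?_⟩
    rw [hΓ, toppleBy_eq_sub_lap, lap_add, sub_sub]

/-- The probability that the total amounts sent by the vertices are given by `Γ` is at most the
probability that `Γ v` is a renewal epoch for every `v`. -/
theorem stabPure_sub_lap_le (c : PureConfig L) (Γ : Fin L → ℤ) :
    stabPure p A c (c - lap Γ) ≤ ∏ v, renewal p (Γ v) := by
  classical
  induction c using topple_induction hp generalizing Γ with
  | h c ih =>
  by_cases hc : PureStable T c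
  · rw [stabPure_of_stable hp A hc, Finsupp.single_apply]
    split_ifs with h
    -- Nothing is toppled, and by injectivity of the Laplacian only the zero vector of totals
    -- describes this.
    · have hΓ : Γ = 0 := by
        apply lap_injective
        rw [lap_zero]
        exact (sub_eq_self.mp h.symm)
      have h1 : 1 ≤ renewal p 0 := by
        rw [renewal_eq hp, if_pos rfl]
        refine le_add_of_nonneg_right (Finset.sum_nonneg fun j _ => ?_)
        exact mul_nonneg (hp.nonneg j) (renewal_nonneg hp _)
      subst hΓ
      simp only [Pi.zero_apply, Finset.prod_const]
      exact one_le_pow₀ h1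
    · exact Finset.prod_nonneg fun v _ => renewal_nonneg hp _
  · set w := A.choose ⟨c, hc⟩ with hw
    have hl : T ≤ c w := A.legal ⟨c, hc⟩
    rw [stabPure_of_not_stable hp A hc, Finsupp.finsetSum_apply]
    -- Condition on the first increment `γ` at `w`; the renewal equation at `Γ w` then bounds the
    -- sum, its nonnegative atom at `0` being discarded.
    calc ∑ γ ∈ p.support, (p γ • stabPure p A (toppleBy γ w c)) (c - lap Γ)
        ≤ ∑ γ ∈ p.support, p γ * ∏ v, renewal p ((Γ - Pi.single w (γ : ℤ) : Fin L → ℤ) v) := by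
          refine Finset.sum_le_sum fun γ hγ => mul_le_mul_of_nonneg_left ?_ (hp.nonneg γ)
          have h1 : c - lap Γ = toppleBy γ w c - lap (Γ - Pi.single w (γ : ℤ)) := by
            rw [toppleBy_eq_sub_lap, lap_sub]
            abel
          rw [h1]
          exact ih w hl γ hγ _
      _ = (∑ γ ∈ p.support, p γ * renewal p (Γ w - γ))
            * ∏ v ∈ Finset.univ.erase w, renewal p (Γ v) := by
          rw [Finset.sum_mul]
          refine Finset.sum_congr rfl fun γ _ => ?_
          rw [← Finset.mul_prod_erase Finset.univ _ (Finset.mem_univ w), mul_assoc, Pi.sub_apply,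
            Pi.single_eq_same]
          congr 2
          refine Finset.prod_congr rfl fun v hv => ?_
          rw [Pi.sub_apply, Pi.single_eq_of_ne (Finset.ne_of_mem_erase hv), sub_zero]
      _ ≤ renewal p (Γ w) * ∏ v ∈ Finset.univ.erase w, renewal p (Γ v) := by
          refine mul_le_mul_of_nonneg_right ?_
            (Finset.prod_nonneg fun v _ => renewal_nonneg hp _)
          rw [renewal_eq hp (Γ w)]
          refine le_add_of_nonneg_left ?_
          split_ifs <;> norm_num
      _ = ∏ v, renewal p (Γ v) :=
          Finset.mul_prod_erase _ (fun v => renewal p (Γ v)) (Finset.mem_univ w)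

theorem sum_delayWeight : ∑ Γ ∈ delays p L, delayWeight p Γ = 1 := by
  classical
  simp only [delays, delayWeight]
  rw [← Finset.prod_univ_sum (fun _ => Finset.Icc 1 (maxIncrement p))
    (fun _ i => normConst p * tail p i)]
  refine Finset.prod_eq_one fun v _ => ?_
  rw [← Finset.mul_sum, ← inv_normConst, mul_inv_cancel₀ (normConst_pos hp).ne']

theorem delayWeight_nonneg (Γ : Fin L → ℕ) : 0 ≤ delayWeight p Γ :=
  Finset.prod_nonneg fun _ _ => mul_nonneg (normConst_pos hp).le (tail_nonneg hp _)

/-- Relative to `c + K`, the shifted start has already sent `Γ`, so reaching `c + K - lap Δ`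
requires sending `Δ - Γ`. Averaging the product of renewal functions over independent delays
factorizes over the vertices, and each factor is at most `C`. -/
theorem sum_delayWeight_mul_stabPure_le (c d : PureConfig L) :
    ∑ Γ ∈ delays p L, delayWeight p Γ * stabPure p A (c + delayShift p Γ) d
      ≤ normConst p ^ L := by
  classical
  set K : PureConfig L := fun _ => 2 * (maxIncrement p : ℤ) with hK
  by_cases hd : ∃ Δ : Fin L → ℤ, d = c + K - lap Δ
  · obtain ⟨Δ, rfl⟩ := hd
    calc ∑ Γ ∈ delays p L, delayWeight p Γ * stabPure p A (c + delayShift p Γ) (c + K - lap Δ)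
        ≤ ∑ Γ ∈ delays p L, ∏ v,
            normConst p * tail p (Γ v) * renewal p (Δ v - (Γ v : ℕ)) := by
          refine Finset.sum_le_sum fun Γ _ => ?_
          rw [Finset.prod_mul_distrib]
          refine mul_le_mul_of_nonneg_left ?_ (delayWeight_nonneg hp Γ)
          have h1 : c + K - lap Δ = c + delayShift p Γ - lap (Δ - fun v => (Γ v : ℤ)) := by
            rw [delayShift, lap_sub]
            abel
          rw [h1]
          exact stabPure_sub_lap_le hp A _ _
      _ = ∏ v : Fin L, ∑ i ∈ Finset.Icc 1 (maxIncrement p),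
            normConst p * tail p i * renewal p (Δ v - (i : ℕ)) :=
          (Finset.prod_univ_sum (fun _ => Finset.Icc 1 (maxIncrement p))
            (fun v i => normConst p * tail p i * renewal p (Δ v - (i : ℕ)))).symm
      _ ≤ ∏ _v : Fin L, normConst p := by
          refine Finset.prod_le_prod (fun v _ => Finset.sum_nonneg fun i _ => ?_) fun v _ => ?_
          · exact mul_nonneg (mul_nonneg (normConst_pos hp).le (tail_nonneg hp i))
              (renewal_nonneg hp _)
          · simp only [mul_assoc]
            rw [← Finset.mul_sum]
            exact mul_le_of_le_one_right (normConst_pos hp).le (sum_tail_mul_renewal_le_one hp _)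
      _ = normConst p ^ L := by simp
  · rw [Finset.sum_eq_zero]
    · exact pow_nonneg (normConst_pos hp).le L
    · intro Γ _
      rw [mul_eq_zero]
      right
      by_contra hne
      obtain ⟨Δ, hΔ⟩ := exists_eq_sub_lap hp A (Finsupp.mem_support_iff.mpr hne)
      refine hd ⟨(fun v => (Γ v : ℤ)) + Δ, ?_⟩
      rw [hΔ, delayShift, lap_add]
      abel

/-- `S` absorbs each `delayShift p Γ`, so it equals the average over `Γ` of the stabilized shifts;
the bound holds uniformly in the starting part `c`. -/
theorem IsSteadyState.apply_le (hT : 2 ≤ T) {S : FormalSum L} (hS : IsSteadyState p A S)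
    (d : PureConfig L) : S d ≤ normConst p ^ L := by
  have h1 : ∀ Γ ∈ delays p L, S d
      = ∑ c ∈ S.support, S c * stabPure p A (c + delayShift p Γ) d := by
    intro Γ hΓ
    conv_lhs => rw [← hS.stab_shift hp A hT (delayShift_nonneg hΓ), ← Finsupp.sum_single S]
    simp only [Finsupp.sum, map_sum, shift_single, Finsupp.finsetSum_apply]
    refine Finset.sum_congr rfl fun c _ => ?_
    rw [← stab_single, ← smul_eq_mul, ← Finsupp.smul_apply, ← map_smul, Finsupp.smul_single,
      smul_eq_mul, mul_one]
  calc S d = ∑ Γ ∈ delays p L, delayWeight p Γ * S d := by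
        rw [← Finset.sum_mul, sum_delayWeight hp, one_mul]
    _ = ∑ Γ ∈ delays p L, ∑ c ∈ S.support,
          S c * (delayWeight p Γ * stabPure p A (c + delayShift p Γ) d) := by
        refine Finset.sum_congr rfl fun Γ hΓ => ?_
        rw [h1 Γ hΓ, Finset.mul_sum]
        exact Finset.sum_congr rfl fun c _ => by ring
    _ = ∑ c ∈ S.support, S c *
          ∑ Γ ∈ delays p L, delayWeight p Γ * stabPure p A (c + delayShift p Γ) d := by
        rw [Finset.sum_comm]
        exact Finset.sum_congr rfl fun c _ => by rw [Finset.mul_sum]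
    _ ≤ ∑ c ∈ S.support, S c * normConst p ^ L :=
        Finset.sum_le_sum fun c _ => mul_le_mul_of_nonneg_left
          (sum_delayWeight_mul_stabPure_le hp A c d) (hS.1.1 c)
    _ = normConst p ^ L := by rw [← Finset.sum_mul, hS.1.2, one_mul]

end

/-! ### The average of `log(RHF)` -/

/-- The weighted distance of a configuration from the threshold. -/
noncomputable def deficit (T : ℤ) (c : PureConfig L) : ℝ :=
  ∑ v : Fin L, ((L : ℝ) - (v : ℕ)) * ((T : ℝ) - c v)

theorem sum_sub_fin (L : ℕ) : ∑ v : Fin L, ((L : ℝ) - (v : ℕ)) = L * (L + 1) / 2 := by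
  rw [Fin.sum_univ_eq_sum_range (fun i => (L : ℝ) - i) L]
  have : ∀ n : ℕ, ∑ i ∈ Finset.range n, ((L : ℝ) - i) = n * L - n * (n - 1) / 2 := by
    intro n
    induction n with
    | zero => simp
    | succ n ih =>
      rw [Finset.sum_range_succ, ih]
      push_cast
      ring
  rw [this]
  ring

theorem logRHF_eq (T : ℤ) (c : PureConfig L) :
    logRHF c = (T * (L * (L + 1) / 2) - deficit T c) / ((L : ℝ) + 1) ^ 2 := by
  have h : ∑ v : Fin L, ((L : ℝ) + 1 - ((v : ℕ) + 1)) * (c v : ℝ)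
      = T * (L * (L + 1) / 2) - deficit T c := by
    rw [← sum_sub_fin, deficit, Finset.mul_sum, ← Finset.sum_sub_distrib]
    exact Finset.sum_congr rfl fun v _ => by ring
  rw [logRHF, h]
  ring

/-- The full geometric series is `1 / (exp t - 1)`. The induction carries the remainder `exp (-(t *
N))`, so that `t + 1 ≤ exp t` suffices at each step. -/
theorem sum_exp_le {t : ℝ} (ht : 0 < t) (T : ℤ) (N : ℕ) :
    ∑ k ∈ Finset.Ico (T - N) T, Real.exp (-(t * ((T : ℝ) - k))) ≤ 1 / t := by
  have key : ∀ N : ℕ, ∑ k ∈ Finset.Ico (T - N) T, Real.exp (-(t * ((T : ℝ) - k)))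
      ≤ (1 - Real.exp (-(t * N))) / t := by
    intro N
    induction N with
    | zero => simp
    | succ N ih =>
      have h : Finset.Ico (T - (N + 1 : ℕ)) T
          = insert (T - (N + 1 : ℕ)) (Finset.Ico (T - N) T) := by
        ext k
        simp only [Finset.mem_insert, Finset.mem_Ico]
        omega
      rw [h, Finset.sum_insert (by rw [Finset.mem_Ico]; omega)]
      have h1 : (T : ℝ) - ((T - (N + 1 : ℕ) : ℤ) : ℝ) = N + 1 := by
        push_cast
        ring
      have h2 : Real.exp (-(t * N)) = Real.exp t * Real.exp (-(t * (N + 1))) := by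
        rw [← Real.exp_add]
        congr 1
        ring
      have h3 := Real.add_one_le_exp t
      have h4 := Real.exp_pos (-(t * ((N : ℝ) + 1)))
      rw [h1]
      push_cast
      rw [le_div_iff₀ ht] at ih ⊢
      rw [h2] at ih
      nlinarith
  refine (key N).trans (div_le_div_of_nonneg_right ?_ ht.le)
  linarith [Real.exp_pos (-(t * N))]

/-- The sum factorizes over the vertices into geometric series with rates `s * (L - v)`; the weights
`L - v` run through `1, …, L` and produce the factorial. -/
theorem sum_exp_deficit_le {s : ℝ} (hs : 0 < s) {F : Finset (PureConfig L)}
    (hF : ∀ c ∈ F, PureStable T c) :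
    ∑ c ∈ F, Real.exp (-(s * deficit T c)) ≤ ((1 / s) ^ L) / (L.factorial : ℝ) := by
  classical
  set N : ℕ := F.sup fun c => Finset.univ.sup fun v => (T - c v).toNat
  have hsub : F ⊆ Fintype.piFinset fun _ => Finset.Ico (T - N) T := by
    intro c hc
    rw [Fintype.mem_piFinset]
    intro v
    have h1 : (T - c v).toNat ≤ N :=
      (Finset.le_sup (f := fun v => (T - c v).toNat) (Finset.mem_univ v)).trans
        (Finset.le_sup (f := fun c => Finset.univ.sup fun v => (T - c v).toNat) hc)
    have h2 := hF c hc v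
    rw [Finset.mem_Ico]
    omega
  calc ∑ c ∈ F, Real.exp (-(s * deficit T c))
      ≤ ∑ c ∈ Fintype.piFinset fun _ : Fin L => Finset.Ico (T - N) T,
          Real.exp (-(s * deficit T c)) :=
        Finset.sum_le_sum_of_subset_of_nonneg hsub fun _ _ _ => (Real.exp_pos _).le
    _ = ∑ c ∈ Fintype.piFinset fun _ : Fin L => Finset.Ico (T - N) T,
          ∏ v : Fin L, Real.exp (-(s * ((L : ℝ) - (v : ℕ)) * ((T : ℝ) - c v))) := by
        refine Finset.sum_congr rfl fun c _ => ?_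
        rw [← Real.exp_sum, deficit, Finset.mul_sum, ← Finset.sum_neg_distrib]
        exact congrArg _ (Finset.sum_congr rfl fun v _ => by ring)
    _ = ∏ v : Fin L, ∑ k ∈ Finset.Ico (T - N) T,
          Real.exp (-(s * ((L : ℝ) - (v : ℕ)) * ((T : ℝ) - k))) :=
        (Finset.prod_univ_sum (fun _ => Finset.Ico (T - N) T) (fun (v : Fin L) (k : ℤ) =>
          Real.exp (-(s * ((L : ℝ) - (v : ℕ)) * ((T : ℝ) - k))))).symm
    _ ≤ ∏ v : Fin L, (1 / s) * (((L : ℝ) - (v : ℕ)))⁻¹ := by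
        refine Finset.prod_le_prod (fun v _ => Finset.sum_nonneg fun _ _ => (Real.exp_pos _).le)
          fun v _ => ?_
        have hv : (0 : ℝ) < (L : ℝ) - (v : ℕ) := sub_pos.mpr (by exact_mod_cast v.2)
        refine (sum_exp_le (mul_pos hs hv) T N).trans (le_of_eq ?_)
        rw [one_div, one_div, mul_inv]
    _ = ((1 / s) ^ L) / (L.factorial : ℝ) := by
        rw [Finset.prod_mul_distrib, Finset.prod_const, Finset.card_univ, Fintype.card_fin,
          Finset.prod_inv_distrib, div_eq_mul_inv]
        congr 2
        rw [← Equiv.prod_comp Fin.revPerm, ← Finset.prod_range_add_one_eq_factorial,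
          Nat.cast_prod, ← Fin.prod_univ_eq_prod_range]
        refine Finset.prod_congr rfl fun v _ => ?_
        rw [Fin.revPerm_apply, Fin.val_rev, Nat.cast_sub (by omega)]
        push_cast
        ring

section
variable {p : ℕ →₀ ℝ} (hp : IsIncrementLaw p T) (A : ChoiceAlgorithm L T)
include hp

/-- The expected deficit in a steady state is at least `C⁻¹ L² / e²`. -/
theorem IsSteadyState.le_avg_deficit (hT : 2 ≤ T) (hL : 0 < L) {S : FormalSum L}
    (hS : IsSteadyState p A S) :
    (normConst p)⁻¹ / Real.exp 1 ^ 2 * (L : ℝ) ^ 2 ≤ ∑ c ∈ S.support, S c * deficit T c := by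
  have hC := normConst_pos hp
  have hL' : (0 : ℝ) < L := by exact_mod_cast hL
  have he := Real.exp_pos 1
  -- With `Lᴸ / L! ≤ eᴸ` the estimate reads `exp (-s E) ≤ (e C / (s L))ᴸ`. This `s` makes the base
  -- `e⁻¹` and maximizes the resulting lower bound for `E`, giving `E ≥ L / s`.
  set s : ℝ := Real.exp 1 ^ 2 * normConst p / L with hs_def
  have hs : 0 < s := by positivity
  set E := ∑ c ∈ S.support, S c * deficit T c with hE
  have hjensen : Real.exp (-(s * E)) ≤ ∑ c ∈ S.support, S c * Real.exp (-(s * deficit T c)) := by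
    have h := convexOn_exp.map_sum_le (t := S.support) (w := S) (p := fun c => -(s * deficit T c))
      (fun c _ => hS.1.1 c) hS.1.2 fun _ _ => Set.mem_univ _
    simp only [smul_eq_mul] at h
    have h2 : ∑ c ∈ S.support, S c * -(s * deficit T c) = -(s * E) := by
      rw [hE, Finset.mul_sum, ← Finset.sum_neg_distrib]
      exact Finset.sum_congr rfl fun c _ => by ring
    rwa [h2] at h
  have hbound : Real.exp (-(s * E)) ≤ Real.exp (-L) := by
    calc Real.exp (-(s * E))
        ≤ ∑ c ∈ S.support, S c * Real.exp (-(s * deficit T c)) := hjensen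
      _ ≤ ∑ c ∈ S.support, normConst p ^ L * Real.exp (-(s * deficit T c)) :=
          Finset.sum_le_sum fun c _ => mul_le_mul_of_nonneg_right (hS.apply_le hp A hT c)
            (Real.exp_pos _).le
      _ ≤ normConst p ^ L * (((1 / s) ^ L) / (L.factorial : ℝ)) := by
          rw [← Finset.mul_sum]
          exact mul_le_mul_of_nonneg_left (sum_exp_deficit_le hs hS.2.1) (pow_nonneg hC.le L)
      _ = (L : ℝ) ^ L / (L.factorial : ℝ) * ((Real.exp 1 ^ 2) ^ L)⁻¹ := by
          rw [← mul_div_assoc, ← mul_pow]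
          have : normConst p * (1 / s) = L * (Real.exp 1 ^ 2)⁻¹ := by
            rw [hs_def]
            field_simp
          rw [this, mul_pow, inv_pow]
          ring
      _ ≤ Real.exp L * ((Real.exp 1 ^ 2) ^ L)⁻¹ :=
          mul_le_mul_of_nonneg_right (Real.pow_div_factorial_le_exp _ hL'.le _) (by positivity)
      _ = Real.exp (-L) := by
          rw [← pow_mul, ← Real.exp_nat_mul, ← Real.exp_neg, ← Real.exp_add]
          congr 1
          push_cast
          ring
  have h1 : (L : ℝ) ≤ s * E := by
    have := Real.exp_le_exp.mp hbound
    linarith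
  have h2 : (normConst p)⁻¹ / Real.exp 1 ^ 2 * (L : ℝ) ^ 2 = L / s := by
    rw [hs_def]
    field_simp
  rw [h2, div_le_iff₀ hs, mul_comm]
  exact h1

theorem IsSteadyState.avgLogRHF_le (hT : 2 ≤ T) (hL : 0 < L) {S : FormalSum L}
    (hS : IsSteadyState p A S) :
    avgLogRHF S ≤ (T : ℝ) / 2
      - (normConst p)⁻¹ / Real.exp 1 ^ 2 * ((L : ℝ) ^ 2 / ((L : ℝ) + 1) ^ 2) := by
  have h := hS.le_avg_deficit hp A hT hL
  have hL' : (0 : ℝ) < (L : ℝ) + 1 := by positivity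
  have h1 : avgLogRHF S = (T * (L * (L + 1) / 2) - ∑ c ∈ S.support, S c * deficit T c)
      / ((L : ℝ) + 1) ^ 2 := by
    have h2 : ∑ c ∈ S.support, S c * ((T : ℝ) * (L * (L + 1) / 2))
        = (T : ℝ) * (L * (L + 1) / 2) := by
      rw [← Finset.sum_mul, hS.1.2, one_mul]
    rw [avgLogRHF, Finsupp.sum, ← h2, ← Finset.sum_sub_distrib, Finset.sum_div]
    refine Finset.sum_congr rfl fun c _ => ?_
    rw [logRHF_eq T]
    ring
  have h3 : (T : ℝ) * (L * (L + 1) / 2) / ((L : ℝ) + 1) ^ 2 ≤ T / 2 := by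
    rw [div_le_iff₀ (by positivity)]
    have : (2 : ℝ) ≤ T := by exact_mod_cast hT
    nlinarith
  rw [h1, sub_div, ← mul_div_assoc (_ / Real.exp 1 ^ 2)]
  exact sub_le_sub h3 (div_le_div_of_nonneg_right h (by positivity))

end

/-! ### The degenerate threshold `T = 1` and the assembly -/

theorem avgLogRHF_nonpos {S : FormalSum L} (hS : IsConfig S) (hst : Stable 1 S) :
    avgLogRHF S ≤ 0 := by
  refine Finset.sum_nonpos fun c hc => mul_nonpos_of_nonneg_of_nonpos (hS.1 c) ?_
  refine mul_nonpos_of_nonneg_of_nonpos (by positivity) (Finset.sum_nonpos fun v _ => ?_)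
  refine mul_nonpos_of_nonneg_of_nonpos ?_ ?_
  · have : ((v : ℕ) : ℝ) ≤ L := by exact_mod_cast v.2.le
    linarith
  · have := hst c hc v
    exact_mod_cast Int.lt_add_one_iff.mp this

theorem inv_normConst_of_threshold_one {p : ℕ →₀ ℝ} (hp : IsIncrementLaw p 1) :
    (normConst p)⁻¹ = 1 := by
  have h : maxIncrement p = 1 := by
    refine le_antisymm (Finset.sup_le fun j hj => ?_) (one_le_maxIncrement hp)
    exact_mod_cast hp.le_threshold j hj
  rw [inv_normConst, h, Finset.Icc_self, Finset.sum_singleton, tail_one hp]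

end SSP

theorem proposition2p9 (p : ℕ →₀ ℝ) (T : ℤ)
    (hp_zero : p 0 = 0) (hp_nonneg : ∀ j, 0 ≤ p j) (hp_sum : ∑ j ∈ p.support, p j = 1)
    (hp_gcd : p.support.gcd id = 1) (hT : ∀ j ∈ p.support, (j : ℤ) ≤ T)
    (ε : ℝ) (hε : 0 < ε) :
    ∃ L₀ : ℕ, ∀ L : ℕ, L₀ ≤ L → ∀ A : SSP.ChoiceAlgorithm L T,
      (∃ S : SSP.FormalSum L, SSP.IsSteadyState p A S ∧
        ((∀ j ∈ p.support, 2 * (j : ℤ) ≤ T) → SSP.Nonneg S)) ∧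
      (2 ≤ T → ∀ S S' : SSP.FormalSum L,
        SSP.IsSteadyState p A S → SSP.IsSteadyState p A S' → S = S') ∧
      (∀ S : SSP.FormalSum L, SSP.IsSteadyState p A S →
        SSP.avgLogRHF S ≤ (T : ℝ) / 2 - (SSP.normConst p)⁻¹ / Real.exp 1 ^ 2 + ε) := by
  have hp : SSP.IsIncrementLaw p T := ⟨hp_zero, hp_nonneg, hp_sum, hT⟩
  set κ : ℝ := (SSP.normConst p)⁻¹ / Real.exp 1 ^ 2 with hκ_def
  have hκ : 0 < κ := div_pos (SSP.inv_normConst_pos hp) (by positivity)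
  -- Replacing `L² / (L + 1)²` by `1` costs at most `2 κ / (L + 1)`, which must not exceed `ε`.
  obtain ⟨L₀, hL₀⟩ := exists_nat_ge (2 * κ / ε)
  refine ⟨L₀ + 1, fun L hL A => ⟨?_, fun h2 S S' hS hS' => hS.unique hp A h2 hS', ?_⟩⟩
  · by_cases h : ∀ j ∈ p.support, 2 * (j : ℤ) ≤ T
    · obtain ⟨S, hS, hS0⟩ := SSP.exists_steadyState hp A (m := 0) le_rfl
        fun j hj => sub_nonneg.mpr (h j hj)
      exact ⟨S, hS, fun _ => hS0⟩
    -- The level `-T` always qualifies, because `j ≤ T` on the support.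
    · obtain ⟨S, hS, -⟩ := SSP.exists_steadyState hp A (m := -T)
        (by have := hp.threshold_pos; omega) fun j hj => by have := hT j hj; omega
      exact ⟨S, hS, fun h' => absurd h' h⟩
  · intro S hS
    -- For `T = 1` the only nonnegative stable pure configuration is zero, so absorption of grains
    -- is unavailable. Instead all heights are at most `0`, and `p` is concentrated at `1`, so `κ =
    -- 1 / e² ≤ 1 / 2` and the claimed bound is already positive.
    rcases (Int.add_one_le_iff.mpr hp.threshold_pos).eq_or_lt with h1 | h2
    · have hT1 : T = 1 := by omega
      subst hT1
      have h3 := SSP.avgLogRHF_nonpos hS.1 hS.2.1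
      have h4 : κ ≤ 1 / 2 := by
        rw [hκ_def, SSP.inv_normConst_of_threshold_one hp]
        refine one_div_le_one_div_of_le two_pos ?_
        nlinarith [Real.add_one_le_exp (1 : ℝ)]
      push_cast
      linarith
    · refine (hS.avgLogRHF_le hp A (by omega) (by omega)).trans ?_
      have hL' : (0 : ℝ) < (L : ℝ) + 1 := by positivity
      have h3 : 1 - 2 / ((L : ℝ) + 1) ≤ (L : ℝ) ^ 2 / ((L : ℝ) + 1) ^ 2 := by
        rw [le_div_iff₀ (by positivity)]
        have : (1 - 2 / ((L : ℝ) + 1)) * ((L : ℝ) + 1) ^ 2 = (L : ℝ) ^ 2 - 1 := by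
          field_simp
          ring
        linarith
      have h4 : κ * (2 / ((L : ℝ) + 1)) ≤ ε := by
        have h5 : (L₀ : ℝ) ≤ L := by exact_mod_cast (Nat.le_succ L₀).trans hL
        rw [← mul_div_assoc, div_le_iff₀ hL']
        rw [div_le_iff₀ hε] at hL₀
        nlinarith
      nlinarith [mul_le_mul_of_nonneg_left h3 hκ.le]
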